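/- For a finite set $A$, let $\mathcal S(A)$ be the group of permutations of $A$; for $\epsilon>0$, call $f_1,f_2\in\mathcal S(A)$ $\epsilon$-similar if $f_1(a)\neq f_2(a)$ for at most $\epsilon|A|$ elements $a\in A$. For a group $G$ and a finite subset $F\subseteq G$, a special $(F,\epsilon)$-quasi-action of $G$ on $A$ is a function $\phi:G\to\mathcal S(A)$ such that (a) $\phi(1)=1$; (b) $\phi(g)^{-1}=\phi(g^{-1})$ for all $g\in G$; (c) $\phi(g)$ has no fixed points for every $g\in F\setminus\{1\}$; (d) $\phi(g_1g_2)$ is $\epsilon$-similar to $\phi(g_1)\phi(g_2)$ for all $g_1,g_2\in F$. A group $G$ is sofic if for every $\epsilon\in(0,1)$ and every finite subset $F\subseteq G$ it admits a special $(F,\epsilon)$-quasi-action on some nonempty finite set. Let $\Gamma$ be a simple graph with an arbitrary (possibly infinite) vertex set $V$, and for each $v\in V$ let $G_v$ be a group. The graph product of the groups $G_v$ with respect to $\Gamma$ is the quotient of their free product by the normal closure of the commutators $[g,h]$ for all $g\in G_v$, $h\in G_w$ with $\{v,w\}$ an edge of $\Gamma$. **Theorem.** If every $G_v$ ($v\in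 V$) is sofic, then the graph product of the groups $G_v$ with respect to $\Gamma$ is sofic. -/

import Mathlib

/-- Two permutations of a finite set `A` are `ε`-similar if they differ on at most `ε|A|`
elements of `A`. -/
def EpsSimilar {A : Type*} (ε : ℝ) (f₁ f₂ : Equiv.Perm A) : Prop :=
  (({a : A | f₁ a ≠ f₂ a}.ncard : ℕ) : ℝ) ≤ ε * (Nat.card A : ℝ)

/-- `φ` is a special `(F, ε)`-quasi-action of the group `G` on the (finite) set `A`. -/
structure IsSpecialQuasiAction {G : Type*} [Group G] (F : Finset G) (ε : ℝ) {A : Type*}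
    (φ : G → Equiv.Perm A) : Prop where
  map_one : φ 1 = 1
  map_inv : ∀ g : G, (φ g)⁻¹ = φ g⁻¹
  no_fixed_points : ∀ g ∈ F, g ≠ 1 → ∀ a : A, φ g a ≠ a
  map_mul : ∀ g₁ ∈ F, ∀ g₂ ∈ F, EpsSimilar ε (φ (g₁ * g₂)) (φ g₁ * φ g₂)

/-- A group is sofic if, for every `ε ∈ (0,1)` and every finite subset `F`, it admits a special
`(F, ε)`-quasi-action on some nonempty finite set. -/
def IsSofic (G : Type*) [Group G] : Prop :=
  ∀ ε : ℝ, 0 < ε → ε < 1 → ∀ F : Finset G,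
    ∃ (A : Type) (_ : Finite A) (_ : Nonempty A) (φ : G → Equiv.Perm A),
      IsSpecialQuasiAction F ε φ

/-- The commutators `[g, h]`, in the free product of the groups `G v`, of elements `g ∈ G v` and
`h ∈ G w` with `v` and `w` adjacent in the graph `Γ`. -/
def graphProductRelators {V : Type*} (Γ : SimpleGraph V) (G : V → Type*) [∀ v, Group (G v)] :
    Set (Monoid.CoprodI G) :=
  {r | ∃ (v w : V) (g : G v) (h : G w), Γ.Adj v w ∧
    r = Monoid.CoprodI.of g * Monoid.CoprodI.of h *
      (Monoid.CoprodI.of g)⁻¹ * (Monoid.CoprodI.of h)⁻¹}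

/-- The graph product of the groups `G v` with respect to the simple graph `Γ`: the quotient of
their free product by the normal closure of the commutators of elements of adjacent groups. -/
abbrev GraphProduct {V : Type*} (Γ : SimpleGraph V) (G : V → Type*) [∀ v, Group (G v)] :=
  Monoid.CoprodI G ⧸ Subgroup.normalClosure (graphProductRelators Γ G)

/-! The retraction onto the graph product of an induced subgraph reduces the theorem to finite
vertex sets.

For finite `V`, let each vertex group act approximately on a finite set `A v`. On `(∀ v, A v) × P`,
with `P` a finite group, a permutation `σ` of `A v` sends the coordinate `a` to `σ a` and multiplies
`P` on the left by `ρ v (ι (σ a) * (ι a)⁻¹)`. This is an exact action of the symmetric group of `A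
v`; it moves nothing where `σ` fixes `a`, and adjacent vertices commute as soon as the `ρ v` do. A
word in fixed-point-free permutations multiplies `P` by a word over the same vertices with
nontrivial letters, so it has no fixed point if `P` detects reduced words of length at most `n`.

`TruncatedPile.act` supplies such `ρ`: letters are pushed onto bounded stacks indexed by
non-adjacent pairs of vertices, and a reduced word applied to empty stacks records its projections
(`act_prod_apply`).

Modulo sequences of vanishing displacement the vertex maps become homomorphisms, so the universal
property applies. Lifting back along reduced words gives almost multiplicative, fixed-point-free
maps, and `doubled` makes inverses exact. -/

/-! ### Normalized Hamming length of permutations -/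

section Displacement

variable {X Y : Type*}

/-- The proportion of points moved by a permutation of a finite set. -/
noncomputable def displacement (σ : Equiv.Perm X) : ℝ :=
  ({x | σ x ≠ x}.ncard : ℝ) / Nat.card X

lemma displacement_nonneg (σ : Equiv.Perm X) : 0 ≤ displacement σ := by
  unfold displacement; positivity

@[simp] lemma displacement_one : displacement (1 : Equiv.Perm X) = 0 := by
  simp [displacement]

@[simp] lemma displacement_inv (σ : Equiv.Perm X) : displacement σ⁻¹ = displacement σ := by
  have h : {x | σ⁻¹ x ≠ x} = {x | σ x ≠ x} := by
    ext x
    simp only [Set.mem_ofPred_eq, ne_eq, Equiv.Perm.inv_eq_iff_eq]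
    exact not_congr eq_comm
  rw [displacement, displacement, h]

lemma displacement_conj (σ τ : Equiv.Perm X) :
    displacement (τ * σ * τ⁻¹) = displacement σ := by
  have h : {x | (τ * σ * τ⁻¹) x ≠ x} = τ '' {x | σ x ≠ x} := by
    ext x
    rw [Equiv.image_eq_preimage_symm]
    simp only [Set.mem_ofPred_eq, Set.mem_preimage, Equiv.Perm.mul_apply, ne_eq,
      ← Equiv.Perm.inv_def, Equiv.Perm.eq_inv_iff_eq]
  rw [displacement, displacement, h, Set.ncard_image_of_injective _ τ.injective]

lemma displacement_mul_le [Finite X] (σ τ : Equiv.Perm X) :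
    displacement (σ * τ) ≤ displacement σ + displacement τ := by
  rw [displacement, displacement, displacement, ← add_div]
  refine div_le_div_of_nonneg_right ?_ (by positivity)
  have h : {x | (σ * τ) x ≠ x} ⊆ {x | σ x ≠ x} ∪ {x | τ x ≠ x} := by
    intro x hx
    by_contra! hc
    simp only [Set.mem_union, Set.mem_ofPred_eq, not_or, not_not] at hc
    exact hx (by rw [Equiv.Perm.mul_apply, hc.2, hc.1])
  exact_mod_cast (Set.ncard_le_ncard h (Set.toFinite _)).trans (Set.ncard_union_le _ _)

/-- A permutation of `X` whose moved points lie over the moved points of a permutation of a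
direct factor `Y` of `X` has no greater displacement. -/
lemma displacement_le_of_equiv_prod [Finite X] {R : Type*} (e : X ≃ Y × R)
    (σ : Equiv.Perm X) (τ : Equiv.Perm Y) (h : ∀ x, τ (e x).1 = (e x).1 → σ x = x) :
    displacement σ ≤ displacement τ := by
  rcases isEmpty_or_nonempty X with hX | ⟨⟨x₀⟩⟩
  · simpa [displacement] using displacement_nonneg τ
  have : Nonempty R := ⟨(e x₀).2⟩
  have : Nonempty Y := ⟨(e x₀).1⟩
  have : Finite (Y × R) := Finite.of_equiv X e
  have : Finite R := Finite.of_surjective (Prod.snd : Y × R → R) Prod.snd_surjective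
  have : Finite Y := Finite.of_surjective (Prod.fst : Y × R → Y) Prod.fst_surjective
  have hsub : {x | σ x ≠ x} ⊆ e ⁻¹' ({y | τ y ≠ y} ×ˢ Set.univ) := by
    intro x hx
    simpa using fun hc => hx (h x hc)
  have hcard : (e ⁻¹' ({y | τ y ≠ y} ×ˢ Set.univ)).ncard =
      {y | τ y ≠ y}.ncard * Nat.card R := by
    rw [← Equiv.image_symm_eq_preimage, Set.ncard_image_of_injective _ e.symm.injective,
      Set.ncard_prod, Set.ncard_univ]
  have hle := Set.ncard_le_ncard hsub (Set.toFinite _)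
  rw [hcard] at hle
  have hR : (0 : ℝ) < Nat.card R := by exact_mod_cast Nat.card_pos
  have hY : (0 : ℝ) < Nat.card Y := by exact_mod_cast Nat.card_pos
  rw [displacement, displacement, Nat.card_congr e, Nat.card_prod, Nat.cast_mul,
    div_le_div_iff₀ (by positivity) hY]
  have hle' : ({x | σ x ≠ x}.ncard : ℝ) ≤ {y | τ y ≠ y}.ncard * Nat.card R := by
    exact_mod_cast hle
  nlinarith

lemma epsSimilar_iff_displacement [Finite X] [Nonempty X] {ε : ℝ} {f g : Equiv.Perm X} :
    EpsSimilar ε f g ↔ displacement (g⁻¹ * f) ≤ ε := by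
  have hX : (0 : ℝ) < Nat.card X := by exact_mod_cast Nat.card_pos
  have h : {x | (g⁻¹ * f) x ≠ x} = {x | f x ≠ g x} := by
    ext x
    simp [Equiv.symm_apply_eq]
  rw [EpsSimilar, displacement, h, div_le_iff₀ hX]

end Displacement

/-! ### Making inverses exact by doubling the set -/

section Doubling

variable {X : Type*}

open Classical in
/-- The permutation of `X × Bool` which agrees with `σ` on both copies of `X` wherever `τ` undoes
`σ`, and otherwise exchanges the copies, acting as `σ` on one and as `τ⁻¹` on the other. -/
noncomputable def doubledFun (σ τ : Equiv.Perm X) (z : X × Bool) : X × Bool :=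
  if τ (σ z.1) = z.1 then (σ z.1, z.2)
  else if z.2 then (τ.symm z.1, false) else (σ z.1, true)

/-- The case distinction is the same at `x` and at its image. In the exchanging case the copy
reached tells which of `σ` and `τ⁻¹` has to be undone. -/
lemma doubledFun_doubledFun (σ τ : Equiv.Perm X) (z : X × Bool) :
    doubledFun τ σ (doubledFun σ τ z) = z := by
  obtain ⟨x, b⟩ := z
  by_cases h : τ (σ x) = x
  · simp [doubledFun, h]
  · have h' : σ x ≠ τ.symm x := fun hc => h (by simp [hc])
    cases b <;> simp [doubledFun, h, h']

/-- `doubledFun` as a permutation. -/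
noncomputable def doubled (σ τ : Equiv.Perm X) : Equiv.Perm (X × Bool) where
  toFun := doubledFun σ τ
  invFun := doubledFun τ σ
  left_inv := doubledFun_doubledFun σ τ
  right_inv := doubledFun_doubledFun τ σ

lemma doubled_inv (σ τ : Equiv.Perm X) : (doubled σ τ)⁻¹ = doubled τ σ := rfl

@[simp] lemma doubled_one_one : doubled (1 : Equiv.Perm X) 1 = 1 := by
  ext z <;> simp [doubled, doubledFun]

/-- Either the point moves as under `σ`, or it changes copy. -/
lemma doubled_apply_ne (σ τ : Equiv.Perm X) (h : ∀ x, σ x ≠ x) (z : X × Bool) :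
    doubled σ τ z ≠ z := by
  obtain ⟨x, b⟩ := z
  change doubledFun σ τ (x, b) ≠ (x, b)
  by_cases hx : τ (σ x) = x
  · simp [doubledFun, hx, h]
  · cases b <;> simp [doubledFun, hx]

lemma displacement_prodCongr_refl_le [Finite X] (σ : Equiv.Perm X) :
    displacement (Equiv.prodCongr σ (Equiv.refl Bool) : Equiv.Perm (X × Bool)) ≤
      displacement σ :=
  displacement_le_of_equiv_prod (Equiv.refl _) _ _ (by rintro ⟨x, b⟩ h; simpa using h)

lemma displacement_prodCongr_inv_mul_doubled_le [Finite X] (σ τ : Equiv.Perm X) :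
    displacement ((Equiv.prodCongr σ (Equiv.refl Bool) : Equiv.Perm (X × Bool))⁻¹ *
      doubled σ τ) ≤ displacement (τ * σ) := by
  refine displacement_le_of_equiv_prod (Equiv.refl _) _ _ ?_
  rintro ⟨x, b⟩ h
  rw [Equiv.Perm.mul_apply, Equiv.Perm.inv_eq_iff_eq]
  change doubledFun σ τ (x, b) = _
  have h' : τ (σ x) = x := h
  simp [doubledFun, h']

end Doubling

/-! ### Weaker criteria for soficity -/

/-- The finite sets in the definition of soficity may be taken in any universe. -/
theorem isSofic_of_universe.{u, w} {G : Type u} [Group G]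
    (h : ∀ ε : ℝ, 0 < ε → ε < 1 → ∀ F : Finset G,
      ∃ (A : Type w) (_ : Finite A) (_ : Nonempty A) (φ : G → Equiv.Perm A),
        IsSpecialQuasiAction F ε φ) : IsSofic G := by
  intro ε hε hε' F
  obtain ⟨A, hA, hA', φ, hφ⟩ := h ε hε hε' F
  let e := Finite.equivFin A
  refine ⟨Fin (Nat.card A), inferInstance, e.nonempty_congr.1 hA',
    fun g => e.permCongr (φ g), ?_, ?_, ?_, ?_⟩
  · ext; simp [hφ.map_one]
  · intro g
    rw [← hφ.map_inv]
    rfl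
  · intro g hg hg1 a ha
    exact hφ.no_fixed_points g hg hg1 (e.symm a) (by
      simpa [Equiv.permCongr_apply, ← Equiv.eq_symm_apply] using ha)
  · intro g₁ hg₁ g₂ hg₂
    have hs : {a | e.permCongr (φ (g₁ * g₂)) a ≠
        (e.permCongr (φ g₁) * e.permCongr (φ g₂)) a} =
        e '' {a | φ (g₁ * g₂) a ≠ (φ g₁ * φ g₂) a} := by
      ext a
      rw [Equiv.image_eq_preimage_symm]
      simp [Equiv.permCongr_apply]
    have := hφ.map_mul g₁ hg₁ g₂ hg₂
    rw [EpsSimilar] at this ⊢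
    rw [hs, Set.ncard_image_of_injective _ e.injective]
    simpa using this

/-- In the definition of soficity, compatibility with inverses is automatic. -/
theorem isSofic_of_approximations.{u, w} {G : Type u} [Group G]
    (h : ∀ ε : ℝ, 0 < ε → ∀ F : Finset G,
      ∃ (A : Type w) (_ : Finite A) (_ : Nonempty A)
      (ψ : G → Equiv.Perm A), ψ 1 = 1 ∧ (∀ g ∈ F, g ≠ 1 → ∀ a, ψ g a ≠ a) ∧
        ∀ g₁ ∈ F, ∀ g₂ ∈ F, displacement ((ψ (g₁ * g₂))⁻¹ * (ψ g₁ * ψ g₂)) ≤ ε) :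
    IsSofic G := by
  classical
  refine isSofic_of_universe fun ε hε _ F => ?_
  set F₁ : Finset G := F ∪ Finset.image₂ (· * ·) F F with hF₁
  -- The final estimate has four error terms: three replacements of `P (ψ g)` by `φ g`, for `g₁`,
  -- `g₂` and `g₁ * g₂`, and one defect of `ψ`. Inverses are included so that `ψ g⁻¹` almost inverts
  -- `ψ g`.
  obtain ⟨A, hA, hA', ψ, h1, hfix, hmul⟩ := h (ε / 4) (by positivity) (F₁ ∪ F₁.image (·⁻¹))
  have hl : ∀ g ∈ F, g ∈ F₁ := fun g hg => Finset.mem_union_left _ hg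
  have hinv : ∀ g ∈ F₁, displacement (ψ g⁻¹ * ψ g) ≤ ε / 4 := by
    intro g hg
    have := hmul g⁻¹ (Finset.mem_union_right _ (Finset.mem_image_of_mem _ hg)) g
      (Finset.mem_union_left _ hg)
    simpa [h1] using this
  let P : Equiv.Perm A → Equiv.Perm (A × Bool) := fun σ => Equiv.prodCongr σ (Equiv.refl Bool)
  have hPm : ∀ σ τ, P (σ * τ) = P σ * P τ := fun σ τ => rfl
  have hPi : ∀ σ, P σ⁻¹ = (P σ)⁻¹ := fun σ => rfl
  let φ : G → Equiv.Perm (A × Bool) := fun g => doubled (ψ g) (ψ g⁻¹)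
  have hφ : ∀ g ∈ F₁, displacement ((P (ψ g))⁻¹ * φ g) ≤ ε / 4 := fun g hg =>
    (displacement_prodCongr_inv_mul_doubled_le _ _).trans (hinv g hg)
  refine ⟨A × Bool, inferInstance, inferInstance, φ, ?_, ?_, ?_, ?_⟩
  · simp [φ, h1]
  · intro g
    simp [φ, doubled_inv]
  · intro g hg hg1
    exact doubled_apply_ne _ _ (hfix g (Finset.mem_union_left _ (hl g hg)) hg1)
  · intro g₁ hg₁ g₂ hg₂
    rw [epsSimilar_iff_displacement]
    have e1 := hφ g₁ (hl _ hg₁)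
    have e2 := hφ g₂ (hl _ hg₂)
    have e3 := hφ (g₁ * g₂) (Finset.mem_union_right _ (Finset.mem_image₂_of_mem hg₁ hg₂))
    have e4 : displacement ((P (ψ (g₁ * g₂)))⁻¹ * (P (ψ g₁) * P (ψ g₂))) ≤ ε / 4 := by
      rw [← hPm, ← hPi, ← hPm]
      exact (displacement_prodCongr_refl_le _).trans
        (hmul _ (Finset.mem_union_left _ (hl _ hg₁)) _ (Finset.mem_union_left _ (hl _ hg₂)))
    generalize φ (g₁ * g₂) = a, φ g₁ = b, φ g₂ = c, P (ψ (g₁ * g₂)) = a', P (ψ g₁) = b',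
      P (ψ g₂) = c' at e1 e2 e3 e4 ⊢
    have key : (b * c)⁻¹ * a =
        (c'⁻¹ * c)⁻¹ * ((c'⁻¹ * (b'⁻¹ * b)⁻¹ * c'⁻¹⁻¹) *
          ((a'⁻¹ * (b' * c'))⁻¹ * (a'⁻¹ * a))) := by group
    rw [key]
    refine (displacement_mul_le _ _).trans ?_
    have t1 := displacement_mul_le (c'⁻¹ * (b'⁻¹ * b)⁻¹ * c'⁻¹⁻¹)
      ((a'⁻¹ * (b' * c'))⁻¹ * (a'⁻¹ * a))
    have t2 := displacement_mul_le (a'⁻¹ * (b' * c'))⁻¹ (a'⁻¹ * a)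
    rw [displacement_conj] at t1
    rw [displacement_inv] at t1 t2 ⊢
    linarith

/-- A group is sofic if its finite subsets are separated from `1` by homomorphisms to sofic
groups. -/
theorem IsSofic.of_forall_finset {G : Type*} [Group G]
    (h : ∀ F : Finset G, ∃ (K : Type*) (_ : Group K) (f : G →* K), IsSofic K ∧
      ∀ g ∈ F, f g = 1 → g = 1) : IsSofic G := by
  classical
  intro ε hε hε' F
  obtain ⟨K, _, f, hK, hf⟩ := h F
  obtain ⟨A, hA, hA', φ, hφ⟩ := hK ε hε hε' (F.image f)
  refine ⟨A, hA, hA', φ ∘ f, ?_, ?_, ?_, ?_⟩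
  · simpa using hφ.map_one
  · intro g
    simpa using hφ.map_inv (f g)
  · intro g hg hg1
    exact hφ.no_fixed_points (f g) (Finset.mem_image_of_mem _ hg) (fun hc => hg1 (hf g hg hc))
  · intro g₁ hg₁ g₂ hg₂
    simpa using hφ.map_mul _ (Finset.mem_image_of_mem f hg₁) _ (Finset.mem_image_of_mem f hg₂)

/-! ### Graph products and reduced words -/

section ReducedWords

variable {V : Type*} (Γ : SimpleGraph V)

/-- The vertex `v` occurs in the list, preceded only by vertices adjacent to `v`. -/
def HeadAbsorbs (v : V) : List V → Prop
  | [] => False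
  | u :: l => u = v ∨ (Γ.Adj v u ∧ HeadAbsorbs v l)

/-- No vertex of the list can be shuffled to meet a later occurrence of itself. -/
def ReducedWord : List V → Prop
  | [] => True
  | v :: l => ¬ HeadAbsorbs Γ v l ∧ ReducedWord l

variable (G : V → Type*) [∀ v, Group (G v)]

/-- The canonical map from a vertex group to the graph product. -/
def GraphProduct.of (v : V) : G v →* GraphProduct Γ G :=
  (QuotientGroup.mk' _).comp Monoid.CoprodI.of

namespace GraphProduct

variable {Γ G}

lemma of_mul_of_comm {v w : V} (h : Γ.Adj v w) (a : G v) (b : G w) :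
    of Γ G v a * of Γ G w b = of Γ G w b * of Γ G v a := by
  have hr : QuotientGroup.mk' (Subgroup.normalClosure (graphProductRelators Γ G))
      (Monoid.CoprodI.of a * Monoid.CoprodI.of b *
        (Monoid.CoprodI.of a)⁻¹ * (Monoid.CoprodI.of b)⁻¹) = 1 :=
    (QuotientGroup.eq_one_iff _).2 (Subgroup.subset_normalClosure ⟨v, w, a, b, h, rfl⟩)
  rw [map_mul, map_mul, map_mul, map_inv, map_inv] at hr
  have := mul_inv_eq_iff_eq_mul.1 hr
  rw [one_mul, mul_inv_eq_iff_eq_mul] at this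
  exact this

/-- The universal property of the graph product. -/
def lift {K : Type*} [Group K] (f : ∀ v, G v →* K)
    (hf : ∀ v w, Γ.Adj v w → ∀ a b, f v a * f w b = f w b * f v a) : GraphProduct Γ G →* K :=
  QuotientGroup.lift _ (Monoid.CoprodI.lift f) (by
    refine Subgroup.normalClosure_le_normal ?_
    rintro _ ⟨v, w, a, b, h, rfl⟩
    simp [MonoidHom.mem_ker, hf v w h a b])

@[simp] lemma lift_of {K : Type*} [Group K] (f : ∀ v, G v →* K)
    (hf : ∀ v w, Γ.Adj v w → ∀ a b, f v a * f w b = f w b * f v a) (v : V) (a : G v) :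
    lift f hf (of Γ G v a) = f v a :=
  Monoid.CoprodI.lift_of f a

variable (Γ G) in
/-- The product in the graph product of a word in the vertex groups. -/
def wordProd (l : List (Σ v, G v)) : GraphProduct Γ G := (l.map fun x => of Γ G x.1 x.2).prod

@[simp] lemma wordProd_nil : wordProd Γ G [] = 1 := rfl

@[simp] lemma wordProd_cons (x : Σ v, G v) (l : List (Σ v, G v)) :
    wordProd Γ G (x :: l) = of Γ G x.1 x.2 * wordProd Γ G l := by
  simp [wordProd]

lemma exists_wordProd_eq (g : GraphProduct Γ G) : ∃ l, wordProd Γ G l = g := by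
  induction g using QuotientGroup.induction_on with
  | H z =>
    induction z using Monoid.CoprodI.induction_left with
    | one => exact ⟨[], rfl⟩
    | mul a z ih =>
      obtain ⟨l, hl⟩ := ih
      exact ⟨⟨_, a⟩ :: l, by rw [wordProd_cons, hl]; rfl⟩

lemma exists_absorb {v : V} (g : G v) (l : List (Σ v, G v))
    (h : HeadAbsorbs Γ v (l.map Sigma.fst)) :
    ∃ l' : List (Σ v, G v), l'.length = l.length ∧
      wordProd Γ G l' = of Γ G v g * wordProd Γ G l := by
  induction l with
  | nil => exact h.elim
  | cons x l ih =>
    obtain ⟨u, k⟩ := x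
    rcases h with rfl | ⟨ha, h⟩
    · exact ⟨⟨u, g * k⟩ :: l, rfl, by simp [mul_assoc]⟩
    · obtain ⟨l', h1, h2⟩ := ih h
      refine ⟨⟨u, k⟩ :: l', by simp [h1], ?_⟩
      rw [wordProd_cons, wordProd_cons, h2, ← mul_assoc, ← mul_assoc, of_mul_of_comm ha]

/-- Every element of a graph product is represented by a reduced word. -/
theorem exists_reducedWord (g : GraphProduct Γ G) :
    ∃ l : List (Σ v, G v), wordProd Γ G l = g ∧ ReducedWord Γ (l.map Sigma.fst) ∧
      ∀ x ∈ l, x.2 ≠ 1 := by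
  suffices H : ∀ (n : ℕ) (l : List (Σ v, G v)), l.length ≤ n → ∃ l' : List (Σ v, G v),
      l'.length ≤ l.length ∧ wordProd Γ G l' = wordProd Γ G l ∧
        ReducedWord Γ (l'.map Sigma.fst) ∧ ∀ x ∈ l', x.2 ≠ 1 by
    obtain ⟨l, rfl⟩ := exists_wordProd_eq g
    obtain ⟨l', -, h⟩ := H _ l le_rfl
    exact ⟨l', h⟩
  intro n
  induction n with
  | zero =>
    intro l hl
    obtain rfl := List.length_eq_zero_iff.1 (Nat.le_zero.1 hl)
    exact ⟨[], by simp [ReducedWord]⟩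
  | succ n ih =>
    intro l hl
    cases l with
    | nil => exact ⟨[], by simp [ReducedWord]⟩
    | cons x l =>
      obtain ⟨l₁, h1, h2, h3, h4⟩ := ih l (by simpa using hl)
      by_cases hx : x.2 = 1
      · exact ⟨l₁, h1.trans (by simp), by simp [h2, hx], h3, h4⟩
      by_cases ha : HeadAbsorbs Γ x.1 (l₁.map Sigma.fst)
      -- Absorbing the head letter leaves a word no longer than the tail, so the induction
      -- hypothesis applies again.
      · obtain ⟨l₂, k1, k2⟩ := exists_absorb x.2 l₁ ha
        obtain ⟨l₃, m1, m2, m3⟩ := ih l₂ (by simp at hl; omega)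
        exact ⟨l₃, by simp; omega, by rw [m2, k2, h2, wordProd_cons], m3⟩
      · exact ⟨x :: l₁, by simpa using h1, by simp [h2], ⟨ha, h3⟩, by simpa [hx] using h4⟩

end GraphProduct

end ReducedWords

/-! ### Reduction to finite graphs -/

/-- The graph product over an induced subgraph is a retract; hence soficity of graph products can
be tested on finite sets of vertices. -/
theorem isSofic_graphProduct_of_finite {V : Type*} (Γ : SimpleGraph V) (G : V → Type*)
    [∀ v, Group (G v)]
    (h : ∀ S : Finset V, IsSofic (GraphProduct (Γ.induce (S : Set V)) fun v => G v.1)) :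
    IsSofic (GraphProduct Γ G) := by
  classical
  refine IsSofic.of_forall_finset fun F => ?_
  choose w hw using fun g : GraphProduct Γ G => GraphProduct.exists_wordProd_eq g
  let S : Finset V := F.biUnion fun g => ((w g).map Sigma.fst).toFinset
  let r : GraphProduct Γ G →* GraphProduct (Γ.induce (S : Set V)) fun v => G v.1 :=
    GraphProduct.lift
      (fun v => if hv : v ∈ (S : Set V) then
        GraphProduct.of (Γ.induce (S : Set V)) (fun v => G v.1) ⟨v, hv⟩ else 1) (by
      intro v u hvu a b
      by_cases hv : v ∈ (S : Set V)
      · by_cases hu : u ∈ (S : Set V)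
        · rw [dif_pos hv, dif_pos hu]
          exact GraphProduct.of_mul_of_comm (Γ := Γ.induce (S : Set V))
            (G := fun v => G v.1) (v := ⟨v, hv⟩) (w := ⟨u, hu⟩) hvu a b
        · rw [dif_neg hu, MonoidHom.one_apply, mul_one, one_mul]
      · rw [dif_neg hv, MonoidHom.one_apply, mul_one, one_mul])
  let i : GraphProduct (Γ.induce (S : Set V)) (fun v => G v.1) →* GraphProduct Γ G :=
    GraphProduct.lift (fun v => GraphProduct.of Γ G v.1)
      (fun v u hvu a b => GraphProduct.of_mul_of_comm (Γ := Γ) (G := G) hvu a b)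
  have key : ∀ l : List (Σ v, G v), (∀ x ∈ l, x.1 ∈ S) →
      i (r (GraphProduct.wordProd Γ G l)) = GraphProduct.wordProd Γ G l := by
    intro l hl
    induction l with
    | nil => simp
    | cons x l ih =>
      have hx : x.1 ∈ (S : Set V) := hl x (by simp)
      rw [GraphProduct.wordProd_cons, map_mul, map_mul, ih fun y hy => hl y (by simp [hy])]
      congr 1
      simp only [r, GraphProduct.lift_of, dif_pos hx]
      exact GraphProduct.lift_of (Γ := Γ.induce (S : Set V)) (G := fun v => G v.1) _ _
        ⟨x.1, hx⟩ x.2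
  refine ⟨_, inferInstance, r, h S, fun g hg h1 => ?_⟩
  have := key (w g) fun x hx => Finset.mem_biUnion.2 ⟨g, hg, by
    rw [List.mem_toFinset]; exact List.mem_map_of_mem hx⟩
  rw [hw, h1, map_one] at this
  exact this.symm

/-! ### Permutations acting on some coordinates only -/

section LocalPerm

variable {E L : Type*} (p : E → Prop)

open Classical in
/-- A permutation of the configurations on the coordinates satisfying `p`, extended to all
configurations. -/
noncomputable def localPerm : Equiv.Perm ({e // p e} → L) →* Equiv.Perm (E → L) where
  toFun π := (Equiv.piEquivPiSubtypeProd p fun _ => L).symm.permCongr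
    (Equiv.prodCongr π (Equiv.refl _))
  map_one' := by ext s e; simp
  map_mul' π π' := by ext s e; simp

lemma localPerm_apply_of_pos (π : Equiv.Perm ({e // p e} → L)) (s : E → L) {e : E} (h : p e) :
    localPerm p π s e = π (fun e => s e) ⟨e, h⟩ := by
  simp [localPerm, h]

lemma localPerm_apply_of_neg (π : Equiv.Perm ({e // p e} → L)) (s : E → L) {e : E} (h : ¬ p e) :
    localPerm p π s e = s e := by
  simp [localPerm, h]

lemma localPerm_commute {p q : E → Prop} (h : ∀ e, p e → ¬ q e)
    (π : Equiv.Perm ({e // p e} → L)) (π' : Equiv.Perm ({e // q e} → L)) :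
    Commute (localPerm p π) (localPerm q π') := by
  ext s e
  rw [Equiv.Perm.mul_apply, Equiv.Perm.mul_apply]
  by_cases hp : p e
  · rw [localPerm_apply_of_pos p _ _ hp, localPerm_apply_of_neg q _ _ (h e hp),
      localPerm_apply_of_pos p _ _ hp]
    exact congrArg (fun t => π t ⟨e, hp⟩)
      (funext fun e' => localPerm_apply_of_neg q _ _ (h _ e'.2))
  · rw [localPerm_apply_of_neg p _ _ hp]
    by_cases hq : q e
    · rw [localPerm_apply_of_pos q _ _ hq, localPerm_apply_of_pos q _ _ hq]
      exact congrArg (fun t => π' t ⟨e, hq⟩)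
        (funext fun e' => (localPerm_apply_of_neg p _ _ fun hc => h _ hc e'.2).symm)
    · rw [localPerm_apply_of_neg q _ _ hq, localPerm_apply_of_neg q _ _ hq,
        localPerm_apply_of_neg p _ _ hp]

end LocalPerm

/-! ### A finite action detecting short reduced words -/

namespace TruncatedPile

variable {V : Type*} (Γ : SimpleGraph V) (H : Type*) (n : ℕ)

/-- The vertex `v` is one of the two members of the non-adjacent pair `e`. -/
def Inc (v : V) (e : V × V) : Prop := ¬ Γ.Adj e.1 e.2 ∧ (e.1 = v ∨ e.2 = v)

variable {Γ} in
lemma Inc.not_of_adj {v w : V} (h : Γ.Adj v w) (e : V × V) (he : Inc Γ v e) : ¬ Inc Γ w e := by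
  obtain ⟨a, b⟩ := e
  rintro ⟨-, h2⟩
  obtain ⟨h0, h1⟩ := he
  dsimp only at h0 h1 h2
  rcases h1 with rfl | rfl <;> rcases h2 with rfl | rfl
  · exact Γ.loopless.irrefl _ h
  · exact h0 h
  · exact h0 h.symm
  · exact Γ.loopless.irrefl _ h

variable (V) in
/-- Words of length at most `n` in the letters `V × H`. -/
abbrev Stack := {l : List (V × H) // l.length ≤ n}

variable {H n} in
/-- The head letter of the list, if any, does not belong to the vertex `v`. -/
def HeadNot (v : V) (l : List (V × H)) : Prop := ∀ x ∈ l.head?, x.1 ≠ v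

/-- The local configurations at `v` on which a letter at `v` can be pushed. -/
abbrev Free (v : V) :=
  {s : {e // Inc Γ v e} → Stack V H n //
    (∃ e, HeadNot v (s e).1) ∧ ∀ e, (s e).1.length < n}

variable {Γ H n}
open Classical in
-- Letters adjacent to `v` are invisible to pairs containing `v`. The first letter not adjacent to
-- `v`, say at `u`, therefore heads the projection to `(v, u)`, and `u ≠ v` since `v` is not
-- absorbed. If there is no such letter, the projection to `(v, v)` is empty.
lemma exists_headNot (v : V) (l : List (V × H)) (h : ¬ HeadAbsorbs Γ v (l.map Prod.fst)) :
    ∃ e, Inc Γ v e ∧ HeadNot v (l.filter fun x => Inc Γ x.1 e) := by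
  induction l with
  | nil => exact ⟨(v, v), ⟨Γ.loopless.irrefl v, Or.inl rfl⟩, by simp [HeadNot]⟩
  | cons x l ih =>
    simp only [List.map_cons, HeadAbsorbs, not_or, not_and] at h
    by_cases ha : Γ.Adj v x.1
    · obtain ⟨e, he, he'⟩ := ih (h.2 ha)
      refine ⟨e, he, ?_⟩
      rwa [List.filter_cons_of_neg (by simpa using Inc.not_of_adj ha e he)]
    · refine ⟨(v, x.1), ⟨ha, Or.inl rfl⟩, ?_⟩
      rw [List.filter_cons_of_pos (by simpa [Inc] using ha)]
      simpa [HeadNot] using h.1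

variable [Group H]

open Classical in
/-- Pushing the letter `(v, h)`, or nothing if `h = 1`. -/
noncomputable def push (v : V) (z : Free Γ H n v × H) : {e // Inc Γ v e} → Stack V H n :=
  if z.2 = 1 then z.1.1 else fun e => ⟨(v, z.2) :: (z.1.1 e).1, z.1.2.2 e⟩

lemma push_one (v : V) (s : Free Γ H n v) : push v (s, 1) = s.1 := by simp [push]

lemma push_of_ne (v : V) (s : Free Γ H n v) {h : H} (hh : h ≠ 1) (e : {e // Inc Γ v e}) :
    (push v (s, h) e).1 = (v, h) :: (s.1 e).1 := by simp [push, hh]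

/-- After a nontrivial push every stack at `v` has its head at `v`, which `Free` forbids. So trivial
and nontrivial pushes never collide, and a nontrivial one is read off from heads and tails. -/
lemma push_injective (v : V) : Function.Injective (push (Γ := Γ) (H := H) (n := n) v) := by
  have aux : ∀ (s s' : Free Γ H n v) (h : H), h ≠ 1 → push v (s, h) ≠ s'.1 := by
    intro s s' h hh hc
    obtain ⟨e, he⟩ := s'.2.1
    rw [← hc, push_of_ne v s hh] at he
    exact he (v, h) (by simp) rfl
  rintro ⟨s, h⟩ ⟨s', h'⟩ heq
  by_cases hh : h = 1
  · subst hh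
    rw [push_one] at heq
    by_cases hh' : h' = 1
    · subst hh'
      rw [push_one] at heq
      rw [Subtype.ext heq]
    · exact (aux s' s h' hh' heq.symm).elim
  · by_cases hh' : h' = 1
    · subst hh'
      rw [push_one] at heq
      exact (aux s s' h hh heq).elim
    · have hcons : ∀ e, (v, h) :: (s.1 e).1 = (v, h') :: (s'.1 e).1 := fun e => by
        rw [← push_of_ne v s hh, ← push_of_ne v s' hh', heq]
      obtain ⟨e, -⟩ := s.2.1
      have h1 : h = h' := by simpa using (List.cons.inj (hcons e)).1
      subst h1
      have h2 : s = s' := by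
        ext e : 2
        exact Subtype.ext (List.cons.inj (hcons e)).2
      rw [h2]

/-- Left multiplication on the second factor. -/
def mulSnd (S K : Type*) [Group K] : K →* Equiv.Perm (S × K) where
  toFun k := Equiv.prodCongr (Equiv.refl S) (Equiv.mulLeft k)
  map_one' := by ext <;> simp
  map_mul' k k' := by ext <;> simp [mul_assoc]

variable (Γ H n) in
/-- The action of the letters at the vertex `v` on truncated piles. -/
noncomputable def act (v : V) : H →* Equiv.Perm (V × V → Stack V H n) :=
  (localPerm (Inc Γ v)).comp
    ((Equiv.Perm.viaEmbeddingHom ⟨push v, push_injective v⟩).comp (mulSnd (Free Γ H n v) H))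

lemma act_commute {v w : V} (h : Γ.Adj v w) (a b : H) :
    Commute (act Γ H n v a) (act Γ H n w b) :=
  localPerm_commute (Inc.not_of_adj h) _ _

lemma act_apply_of_neg (v : V) (h : H) (s : V × V → Stack V H n) {e : V × V}
    (he : ¬ Inc Γ v e) : act Γ H n v h s e = s e :=
  localPerm_apply_of_neg _ _ _ he

lemma act_apply_of_pos (v : V) {h : H} (hh : h ≠ 1) (s : V × V → Stack V H n)
    (h1 : ∃ e, Inc Γ v e ∧ HeadNot v (s e).1) (h2 : ∀ e, Inc Γ v e → (s e).1.length < n)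
    {e : V × V} (he : Inc Γ v e) : (act Γ H n v h s e).1 = (v, h) :: (s e).1 := by
  let t : Free Γ H n v := ⟨fun e => s e,
    ⟨by obtain ⟨e, h, h'⟩ := h1; exact ⟨⟨e, h⟩, h'⟩, fun e => h2 e e.2⟩⟩
  -- The local configuration is the pushed image of the neutral element, which left multiplication
  -- by `h` carries to the push of `h`.
  have ht : (fun e : {e // Inc Γ v e} => s e) =
      (⟨push v, push_injective v⟩ : Free Γ H n v × H ↪ _) (t, 1) := (push_one v t).symm
  have key : act Γ H n v h s e = push v (t, h) ⟨e, he⟩ := by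
    rw [act, MonoidHom.comp_apply, localPerm_apply_of_pos _ _ _ he, MonoidHom.comp_apply,
      Equiv.Perm.viaEmbeddingHom_apply, ht, Equiv.Perm.viaEmbedding_apply]
    simp [mulSnd]
  rw [key, push_of_ne v t hh]

open Classical in
/-- A short reduced word, acting on the empty pile, writes down its own projections. -/
lemma act_prod_apply (l : List (V × H)) (h1 : ∀ x ∈ l, x.2 ≠ 1)
    (h2 : ReducedWord Γ (l.map Prod.fst)) (h3 : l.length ≤ n) (e : V × V) :
    ((l.map fun x => act Γ H n x.1 x.2).prod (fun _ => ⟨[], Nat.zero_le n⟩) e).1 =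
      l.filter fun x => Inc Γ x.1 e := by
  induction l generalizing e with
  | nil => simp
  | cons x l ih =>
    have ih' := ih (fun y hy => h1 y (by simp [hy])) h2.2 ((Nat.le_succ _).trans h3)
    rw [List.map_cons, List.prod_cons, Equiv.Perm.mul_apply]
    generalize (l.map fun x => act Γ H n x.1 x.2).prod (fun _ => ⟨[], Nat.zero_le n⟩) = s at ih'
    by_cases he : Inc Γ x.1 e
    · rw [act_apply_of_pos _ (h1 x (by simp)) _ _ _ he, ih',
        List.filter_cons_of_pos (by simpa using he)]
      -- Reducedness makes the push legal here; the length bound leaves room for it.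
      · obtain ⟨e', k1, k2⟩ := exists_headNot x.1 l h2.1
        exact ⟨e', k1, by rwa [ih']⟩
      · intro e' _
        rw [ih']
        exact (List.length_filter_le _ _).trans_lt h3
    · rw [act_apply_of_neg _ _ _ he, ih', List.filter_cons_of_neg (by simpa using he)]

lemma act_prod_ne_one (l : List (V × H)) (h0 : l ≠ []) (h1 : ∀ x ∈ l, x.2 ≠ 1)
    (h2 : ReducedWord Γ (l.map Prod.fst)) (h3 : l.length ≤ n) :
    (l.map fun x => act Γ H n x.1 x.2).prod ≠ 1 := by
  classical
  intro hc
  obtain ⟨x, l, rfl⟩ := List.exists_cons_of_ne_nil h0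
  have := act_prod_apply (x :: l) h1 h2 h3 (x.1, x.1)
  rw [hc, List.filter_cons_of_pos (by simp [Inc])] at this
  simp at this

end TruncatedPile

/-! ### Coupling point permutations to a finite group -/

section TwistedAction

variable {V : Type*} {A : V → Type*} {H P : Type*} [Group H] [Group P]

open Classical in
/-- A permutation of the coordinate `A v`, acting on `(∀ v, A v) × P` with a twist on the group
`P` that records the change of coordinate. -/
noncomputable def twistedAct (ι : ∀ v, A v → H) (ρ : V → H →* P) (v : V) :
    Equiv.Perm (A v) →* Equiv.Perm ((∀ v, A v) × P) :=
  MonoidHom.toHomPerm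
    { toFun := fun σ z => (Function.update z.1 v (σ (z.1 v)),
        ρ v (ι v (σ (z.1 v)) * (ι v (z.1 v))⁻¹) * z.2)
      map_one' := by funext z; simp [Function.End.one_def]
      -- The twists telescope: the factor `ι v (τ a)` cancels.
      map_mul' := fun σ τ => by
        funext z
        change _ = (_, _ * (_ * _))
        simp [mul_assoc] }

variable (ι : ∀ v, A v → H) (ρ : V → H →* P)

open Classical in
lemma twistedAct_apply (v : V) (σ : Equiv.Perm (A v)) (z : (∀ v, A v) × P) :
    twistedAct ι ρ v σ z = (Function.update z.1 v (σ (z.1 v)),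
        ρ v (ι v (σ (z.1 v)) * (ι v (z.1 v))⁻¹) * z.2) := rfl

lemma twistedAct_commute {v w : V} (hvw : v ≠ w) (h : ∀ a b, Commute (ρ v a) (ρ w b))
    (σ : Equiv.Perm (A v)) (τ : Equiv.Perm (A w)) :
    Commute (twistedAct ι ρ v σ) (twistedAct ι ρ w τ) := by
  classical
  refine Equiv.ext fun z => ?_
  simp only [Equiv.Perm.mul_apply, twistedAct_apply]
  rw [Function.update_of_ne hvw, Function.update_of_ne hvw.symm, Function.update_comm hvw,
    ← mul_assoc, ← mul_assoc, (h _ _).eq]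

lemma displacement_twistedAct_le [Finite ((∀ v, A v) × P)] (v : V) (σ : Equiv.Perm (A v)) :
    displacement (twistedAct ι ρ v σ) ≤ displacement σ := by
  classical
  refine displacement_le_of_equiv_prod
    ((Equiv.prodCongr (Equiv.piSplitAt v A) (Equiv.refl P)).trans (Equiv.prodAssoc _ _ _)) _ _ ?_
  intro z hz
  have hz' : σ (z.1 v) = z.1 v := hz
  simp [twistedAct_apply, hz']

/-- The letters of `l'` depend on `z`, but each is nontrivial because its permutation moves the
current coordinate and `ι` is injective. Reducedness depends on the vertices alone, so it passes to
`l'`. -/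
lemma twistedAct_prod_apply_snd (hι : ∀ v, Function.Injective (ι v))
    (l : List (Σ v, Equiv.Perm (A v))) (hl : ∀ x ∈ l, ∀ a, x.2 a ≠ a) (z : (∀ v, A v) × P) :
    ∃ l' : List (V × H), l'.map Prod.fst = l.map Sigma.fst ∧ (∀ x ∈ l', x.2 ≠ 1) ∧
      ((l.map fun x => twistedAct ι ρ x.1 x.2).prod z).2 =
        (l'.map fun x => ρ x.1 x.2).prod * z.2 := by
  induction l with
  | nil => exact ⟨[], by simp⟩
  | cons x l ih =>
    obtain ⟨l', h1, h2, h3⟩ := ih fun y hy => hl y (by simp [hy])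
    rw [List.map_cons (f := fun x : Σ v, Equiv.Perm (A v) => twistedAct ι ρ x.1 x.2),
      List.prod_cons, Equiv.Perm.mul_apply, twistedAct_apply, h3]
    set y := ((l.map fun x => twistedAct ι ρ x.1 x.2).prod z).1
    refine ⟨(x.1, ι x.1 (x.2 (y x.1)) * (ι x.1 (y x.1))⁻¹) :: l', by simp [h1], ?_,
      by simp [mul_assoc]⟩
    simp only [List.mem_cons, forall_eq_or_imp]
    refine ⟨fun hc => hl x (by simp) (y x.1) (hι x.1 (mul_inv_eq_one.1 hc)), h2⟩

end TwistedAction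

/-- Finitely many finite symmetric groups, indexed by the vertices of a graph, act on a common
finite set so that groups at adjacent vertices commute, displacements do not grow, and short
reduced words in fixed-point-free permutations have no fixed points. -/
theorem exists_commuting_actions.{u} {V : Type u} [Finite V] (Γ : SimpleGraph V) (A : V → Type)
    [∀ v, Finite (A v)] [∀ v, Nonempty (A v)] (n : ℕ) :
    ∃ (X : Type u) (_ : Finite X) (_ : Nonempty X) (Ψ : ∀ v, Equiv.Perm (A v) →* Equiv.Perm X),
      (∀ v w, Γ.Adj v w → ∀ σ τ, Commute (Ψ v σ) (Ψ w τ)) ∧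
      (∀ v σ, displacement (Ψ v σ) ≤ displacement σ) ∧
      ∀ l : List (Σ v, Equiv.Perm (A v)), l ≠ [] → l.length ≤ n →
        ReducedWord Γ (l.map Sigma.fst) → (∀ x ∈ l, ∀ a, x.2 a ≠ a) →
          ∀ x, (l.map fun x => Ψ x.1 x.2).prod x ≠ x := by
  classical
  -- Any finite group into which every `A v` injects would serve; here points become basis vectors.
  let H := Multiplicative ((Σ v, A v) → ZMod 2)
  let ι : ∀ v, A v → H := fun v a => Multiplicative.ofAdd (Pi.single ⟨v, a⟩ 1)
  have hι : ∀ v, Function.Injective (ι v) := by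
    intro v a b hab
    have h1 : (Pi.single ⟨v, a⟩ 1 : (Σ v, A v) → ZMod 2) = Pi.single ⟨v, b⟩ 1 := hab
    have h2 := congrFun h1 ⟨v, a⟩
    by_contra hne
    rw [Pi.single_eq_same, Pi.single_eq_of_ne (by simpa using hne)] at h2
    exact one_ne_zero h2
  have : Finite H := inferInstanceAs (Finite ((Σ v, A v) → ZMod 2))
  have : Finite (TruncatedPile.Stack V H n) := List.finite_length_le (V × H) n
  let P := Equiv.Perm (V × V → TruncatedPile.Stack V H n)
  let ρ : V → H →* P := TruncatedPile.act Γ H n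
  refine ⟨(∀ v, A v) × P, inferInstance, inferInstance, twistedAct ι ρ, ?_, ?_, ?_⟩
  · exact fun v w h σ τ => twistedAct_commute ι ρ h.ne (TruncatedPile.act_commute h) σ τ
  · exact displacement_twistedAct_le ι ρ
  · intro l h0 h1 h2 h3 z hz
    obtain ⟨l', k1, k2, k3⟩ := twistedAct_prod_apply_snd ι ρ hι l h3 z
    -- A fixed point would force the word `l'` to act trivially on piles.
    rw [hz, eq_comm, mul_eq_right] at k3
    have hlen : l'.length = l.length := by simpa using congrArg List.length k1
    refine TruncatedPile.act_prod_ne_one l' ?_ k2 (k1 ▸ h2) (hlen.trans_le h1) k3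
    rw [← List.length_pos_iff, hlen]
    exact List.length_pos_iff.2 h0

/-! ### Sequences of permutations modulo vanishing displacement -/

section Limit

open Filter Topology

variable {I : Type*} (X : I → Type*) [∀ i, Finite (X i)] (l : Filter I)

/-- The sequences of permutations whose displacement tends to zero. -/
def nullSequences : Subgroup (∀ i, Equiv.Perm (X i)) where
  carrier := {σ | Tendsto (fun i => displacement (σ i)) l (𝓝 0)}
  one_mem' := by simpa using tendsto_const_nhds
  inv_mem' := by simp
  mul_mem' := by
    intro σ τ hσ hτ
    refine squeeze_zero (fun i => displacement_nonneg _)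
      (fun i => displacement_mul_le (σ i) (τ i)) ?_
    simpa using Tendsto.add hσ hτ

lemma mem_nullSequences {σ : ∀ i, Equiv.Perm (X i)} :
    σ ∈ nullSequences X l ↔ Tendsto (fun i => displacement (σ i)) l (𝓝 0) := Iff.rfl

instance : (nullSequences X l).Normal where
  conj_mem σ hσ τ := by
    simpa [mem_nullSequences, displacement_conj] using hσ

end Limit

/-! ### Assembling the approximations over a finite graph -/

section FiniteGraph

open Filter Topology

variable {V : Type*} [Finite V] (Γ : SimpleGraph V) (G : V → Type*) [∀ v, Group (G v)]

theorem isSofic_graphProduct_of_finite_vertices (hG : ∀ v, IsSofic (G v)) :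
    IsSofic (GraphProduct Γ G) := by
  classical
  let I := Finset (Σ v, G v) × ℕ
  have sys : ∀ (i : I) (v : V), ∃ (A : Type) (_ : Finite A) (_ : Nonempty A)
      (φ : G v → Equiv.Perm A),
      IsSpecialQuasiAction (i.1.preimage (Sigma.mk v) sigma_mk_injective.injOn)
        -- The denominator `n + 2` keeps the tolerance below `1` even at `n = 0`.
        (1 / ((i.2 : ℝ) + 1 + 1)) φ := fun i v => hG v _ (by positivity)
      (by rw [div_lt_one (by positivity)]; linarith [(Nat.cast_nonneg i.2 : (0 : ℝ) ≤ i.2)]) _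
  choose A hA hA' φ hφ using sys
  choose X hX hX' Ψ hcomm hdisp hfree using fun i : I => exists_commuting_actions Γ (A i) i.2
  let N := nullSequences X (atTop : Filter I)
  have hlim : Tendsto (fun i : I => 1 / ((i.2 : ℝ) + 1 + 1)) atTop (𝓝 0) := by
    have h1 : Tendsto (fun i : I => i.2 + 1) atTop atTop := by
      refine (tendsto_add_atTop_nat 1).comp ?_
      rw [← prod_atTop_atTop_eq]
      exact tendsto_snd
    simpa [Function.comp_def] using
      (tendsto_one_div_add_atTop_nhds_zero_nat (𝕜 := ℝ)).comp h1
  let f : ∀ v, G v →* (∀ i, Equiv.Perm (X i)) ⧸ N := fun v =>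
    MonoidHom.mk' (fun g => QuotientGroup.mk' N fun i => Ψ i v (φ i v g)) (by
      intro a b
      rw [← map_mul, eq_comm]
      refine QuotientGroup.eq.2 (squeeze_zero' (.of_forall fun i => displacement_nonneg _) ?_ hlim)
      filter_upwards [eventually_ge_atTop (({⟨v, a⟩, ⟨v, b⟩}, 0) : I)] with i hi
      have hmem : ∀ c, c = a ∨ c = b → c ∈ i.1.preimage (Sigma.mk v) sigma_mk_injective.injOn :=
        fun c hc => Finset.mem_preimage.2 (hi.1 (by rcases hc with rfl | rfl <;> simp))
      have := epsSimilar_iff_displacement.1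
        ((hφ i v).map_mul a (hmem a (.inl rfl)) b (hmem b (.inr rfl)))
      refine le_trans ?_ this
      have h := hdisp i v ((φ i v a * φ i v b)⁻¹ * φ i v (a * b))
      rwa [map_mul, map_inv, map_mul] at h)
  have hf : ∀ v w, Γ.Adj v w → ∀ a b, f v a * f w b = f w b * f v a := by
    intro v w h a b
    change QuotientGroup.mk' N _ * QuotientGroup.mk' N _ =
      QuotientGroup.mk' N _ * QuotientGroup.mk' N _
    rw [← map_mul, ← map_mul]
    congr 1
    funext i
    exact hcomm i v w h _ _
  let Φ := GraphProduct.lift f hf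
  have hword : ∀ l : List (Σ v, G v), QuotientGroup.mk' N
      (fun i => (l.map fun x => Ψ i x.1 (φ i x.1 x.2)).prod) = Φ (GraphProduct.wordProd Γ G l) := by
    intro l
    induction l with
    | nil => exact (map_one _).trans (map_one Φ).symm
    | cons x l ih =>
      rw [GraphProduct.wordProd_cons, map_mul, ← ih, GraphProduct.lift_of]
      change _ = QuotientGroup.mk' N _ * QuotientGroup.mk' N _
      rw [← map_mul]
      congr 1
  choose w hw hred hne using fun g : GraphProduct Γ G => GraphProduct.exists_reducedWord g
  -- The value at `1` is set by hand, as the word chosen for `1` has not been shown to be empty.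
  let σ : GraphProduct Γ G → ∀ i, Equiv.Perm (X i) := fun g =>
    if g = 1 then 1 else fun i => ((w g).map fun x => Ψ i x.1 (φ i x.1 x.2)).prod
  have hσ : ∀ g, QuotientGroup.mk' N (σ g) = Φ g := by
    intro g
    by_cases hg : g = 1
    · simp [σ, hg]
    · simp only [σ, if_neg hg]
      rw [hword, hw]
  refine isSofic_of_approximations fun ε hε F => ?_
  have ev1 : ∀ᶠ i in atTop, ∀ g ∈ F, g ≠ 1 → ∀ a, σ g i a ≠ a := by
    refine (Finset.eventually_all F).2 fun g hg => ?_
    -- From this index on, all letters of the word act without fixed points and its length is within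
    -- the bound.
    filter_upwards [eventually_ge_atTop ((w g).toFinset, (w g).length)] with i hi hg1
    simp only [σ, if_neg hg1]
    have := hfree i ((w g).map fun x => ⟨x.1, φ i x.1 x.2⟩) ?_ (by simpa using hi.2)
      (by simpa [Function.comp_def] using hred g) ?_
    · simpa [Function.comp_def] using this
    · intro hc
      rw [List.map_eq_nil_iff] at hc
      exact hg1 (by rw [← hw g, hc, GraphProduct.wordProd_nil])
    · intro x hx
      obtain ⟨y, hy, rfl⟩ := List.mem_map.1 hx
      exact (hφ i y.1).no_fixed_points y.2
        (Finset.mem_preimage.2 (hi.1 (List.mem_toFinset.2 hy))) (hne g y hy)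
  have ev2 : ∀ᶠ i in atTop, ∀ g₁ ∈ F, ∀ g₂ ∈ F,
      displacement ((σ (g₁ * g₂) i)⁻¹ * (σ g₁ i * σ g₂ i)) ≤ ε := by
    refine (Finset.eventually_all F).2 fun g₁ _ => (Finset.eventually_all F).2 fun g₂ _ => ?_
    have hmem : (σ (g₁ * g₂))⁻¹ * (σ g₁ * σ g₂) ∈ N := by
      rw [← QuotientGroup.eq_one_iff]
      change QuotientGroup.mk' N _ = 1
      simp [map_mul, map_inv, hσ]
    exact (Tendsto.eventually_lt_const hε hmem).mono fun i hi => hi.le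
  obtain ⟨i, hi1, hi2⟩ := (ev1.and ev2).exists
  exact ⟨X i, hX i, hX' i, fun g => σ g i, by simp [σ], hi1, hi2⟩

end FiniteGraph

theorem theorem1 {V : Type*} (Γ : SimpleGraph V) (G : V → Type*) [∀ v, Group (G v)]
    (hG : ∀ v, IsSofic (G v)) : IsSofic (GraphProduct Γ G) := by
  exact isSofic_graphProduct_of_finite Γ G fun S =>
    isSofic_graphProduct_of_finite_vertices _ _ fun v => hG v.1
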